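/- Let $X$ and $Y$ be complex Banach spaces, let $L(Y,X)$ be the Banach space of bounded linear maps from $Y$ to $X$, and write $L(X)=L(X,X)$. An operator $T\in L(X)$ is called Drazin invertible if there exist $S\in L(X)$ and $m\in\mathbb N$ such that $T^m=T^mST$, $STS=S$ and $TS=ST$. The Drazin spectrum of $T$ is $\sigma_{DR}(T)=\{\lambda\in\mathbb C : T-\lambda I \text{ is not Drazin invertible}\}$, and $\sigma(T)$ denotes the spectrum of $T$. Let $A\in L(X)$ and $B\in L(Y)$, and let $\rho\in L(L(Y,X))$ be the generalized derivation $\rho(U)=AU-UB$. Then $$\sigma_{DR}(\rho)=(\sigma_{DR}(A)-\sigma(B))\cup(\sigma(A)-\sigma_{DR}(B)),$$ where, for $S,T\subseteq\mathbb C$, $S-T=\{s-t : s\in S,\ t\in T\}$. -/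

import Mathlib

open scoped Pointwise

/-- An element `a` of a monoid is Drazin invertible if there are an element `b` and `m : ℕ` with
`a ^ m = a ^ m * b * a`, `b * a * b = b` and `a * b = b * a`. -/
def IsDrazinInvertible {M : Type*} [Monoid M] (a : M) : Prop :=
  ∃ (b : M) (m : ℕ), a ^ m = a ^ m * b * a ∧ b * a * b = b ∧ a * b = b * a

/-- The Drazin spectrum of a bounded operator `T` on a complex normed space: the set of all
complex `z` such that `T - z` is not Drazin invertible in the algebra of bounded operators. -/
def drazinSpectrum {E : Type*} [NormedAddCommGroup E] [NormedSpace ℂ E] (T : E →L[ℂ] E) : Set ℂ :=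
  {z : ℂ | ¬ IsDrazinInvertible (T - z • ContinuousLinearMap.id ℂ E)}

/-- The generalized derivation `U ↦ A U - U B`, as a bounded operator on the space of
bounded operators from `Y` to `X` with the operator norm. -/
noncomputable def generalizedDerivation {X Y : Type*}
    [NormedAddCommGroup X] [NormedSpace ℂ X] [NormedAddCommGroup Y] [NormedSpace ℂ Y]
    (A : X →L[ℂ] X) (B : Y →L[ℂ] Y) : (Y →L[ℂ] X) →L[ℂ] (Y →L[ℂ] X) :=
  ContinuousLinearMap.compL ℂ Y X X A - (ContinuousLinearMap.compL ℂ Y Y X).flip B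

theorem generalizedDerivation_apply {X Y : Type*}
    [NormedAddCommGroup X] [NormedSpace ℂ X] [NormedAddCommGroup Y] [NormedSpace ℂ Y]
    (A : X →L[ℂ] X) (B : Y →L[ℂ] Y) (U : Y →L[ℂ] X) :
    generalizedDerivation A B U = A ∘L U - U ∘L B :=
  rfl

/-!
Shifting the coefficients by scalars, everything reduces to two facts about `ρ U = A U - U B`.

*If `A` and `B` are Drazin invertible at every common spectral value (after subtraction of that
value), then `ρ` is Drazin invertible.* Drazin invertible spectral values are isolated
(`IsDrazinInvertible.eventually_isUnit_sub`), so the common spectral values form a finite set `K`.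
The operator `ρ` is the difference of the commuting operators `a : U ↦ A U` and `b : U ↦ U B`, and
the bicommutant of these is a commutative Banach algebra containing their Drazin inverses. There,
let `p z`, `q z` be the spectral idempotents of `a` and `b` at `z ∈ K`, and put
`e = 1 - ∏ z ∈ K, (1 - p z * q z)`. Then `(a - b) * e` is nilpotent, and `a - b + e` is invertible
since no character vanishes on it (`isDrazinInvertible_sub_of_finite`). Thus `e` is a spectral
idempotent for `a - b`.

*If `ρ` is Drazin invertible and `A` is not invertible, then `B` is Drazin invertible, and likewise
with `A` and `B` exchanged.* Let `D` be the Drazin inverse of `ρ`. Choose bounded `x n ∈ X` and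
functionals `f n` with `f n (x n) = 1` such that either `A (x n) → 0` or `f n ∘ A = 0`
(`exists_approximate_kernel`). On the rank one operators `x n ⊗ g`, tested against `f n`, the
derivation acts in the limit as minus the adjoint of `B`. Hence the ultrafilter limit
`w g y = lim f n (D (x n ⊗ g) y)` is, up to sign, a Drazin inverse of the adjoint of `B`
(`isDrazinInvertible_of_asymptotic`), and Drazin invertibility descends from the adjoint to the
operator (`isDrazinInvertible_of_dual`). Taking limits in the dual space is what makes weak limits
available without any reflexivity assumption; for `A` the limit `lim g (D (x ⊗ f n) (y n))` is used.
-/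

universe u

open Filter Topology

/-! ### Drazin invertibility in monoids and rings -/

theorem pow_add_mul_pow_of_pow_succ_mul {M : Type*} [Monoid M] {a b : M} {m : ℕ}
    (h : a ^ (m + 1) * b = a ^ m) (k : ℕ) : a ^ (m + k) * b ^ k = a ^ m := by
  induction k with
  | zero => simp
  | succ k ih =>
    have : a ^ (m + (k + 1)) * b = a ^ (m + k) := by
      rw [show m + (k + 1) = k + (m + 1) by ring, pow_add a k, mul_assoc, h, ← pow_add, add_comm]
    rw [pow_succ' b, ← mul_assoc, this, ih]

/-- A commuting `b` with `a ^ (m + 1) * b = a ^ m` need not satisfy `b * a * b = b`, but then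
`a ^ m * b ^ (m + 1)` is a Drazin inverse of `a`. -/
theorem IsDrazinInvertible.of_pow_succ_mul {M : Type*} [Monoid M] {a b : M} {m : ℕ}
    (hc : Commute a b) (h : a ^ (m + 1) * b = a ^ m) : IsDrazinInvertible a := by
  have hk := pow_add_mul_pow_of_pow_succ_mul h
  have hab : Commute a (a ^ m * b ^ (m + 1)) :=
    (Commute.self_pow a m).mul_right (hc.pow_right _)
  have key : a * (a ^ m * b ^ (m + 1)) = a ^ m * b ^ m := by
    rw [← mul_assoc, ← pow_succ', pow_succ' b, ← mul_assoc, h]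
  refine ⟨a ^ m * b ^ (m + 1), m, ?_, ?_, hab.eq⟩
  · rw [mul_assoc, ← hab.eq, key, ← mul_assoc, ← pow_add, hk]
  · have hb : Commute (b ^ m) (a ^ m) := (hc.pow_pow m m).symm
    rw [← hab.eq, key, mul_assoc, ← mul_assoc (b ^ m), hb.eq, ← mul_assoc, ← mul_assoc,
      ← pow_add, hk]

/-- A Drazin inverse of `a` commutes with everything that commutes with `a`. -/
theorem Commute.drazin_inverse {R : Type*} [Ring R] {a b c : R} {m : ℕ}
    (h : a ^ m = a ^ m * b * a) (hb : b * a * b = b) (hc : Commute a b) (hca : Commute c a) :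
    Commute c b := by
  have hp : IsIdempotentElem (a * b) := by
    rw [IsIdempotentElem, mul_assoc, ← mul_assoc b, hb]
  have hpp : a ^ m * (a * b) = a ^ m := by rw [hc.eq, ← mul_assoc, ← h]
  have hpp' : (a * b) * a ^ m = a ^ m := by
    rw [← ((Commute.pow_self a m).mul_right (hc.pow_left m)).eq, hpp]
  -- The idempotent `p = a * b` satisfies `p * c * p = c * p` and `p * c * p = p * c`.
  have hcm : Commute c (a ^ m) := hca.pow_right m
  have hpow : ∃ d, a * b = a ^ m * d ∧ a * b = d * a ^ m := by
    rcases Nat.eq_zero_or_pos m with rfl | hm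
    · exact ⟨a * b, by simp, by simp⟩
    · refine ⟨b ^ m, ?_, ?_⟩
      · rw [← hc.mul_pow, hp.pow_eq hm.ne']
      · rw [← (hc.pow_pow m m).eq, ← hc.mul_pow, hp.pow_eq hm.ne']
  obtain ⟨d, hd, hd'⟩ := hpow
  have h1 : a * b * (c * (a * b)) = c * (a * b) := by
    have : c * (a * b) = a ^ m * (c * d) := by rw [hd, ← mul_assoc, hcm.eq, mul_assoc]
    rw [this, ← mul_assoc, hpp']
  have h2 : a * b * c * (a * b) = a * b * c := by
    have : a * b * c = d * c * a ^ m := by rw [hd', mul_assoc, ← hcm.eq, mul_assoc]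
    rw [this, mul_assoc, hpp]
  have h3 : Commute c (a * b) := by
    rw [Commute, SemiconjBy, ← h1, ← mul_assoc, h2]
  have hbp : b * (a * b) = b := by rw [← mul_assoc, hb]
  have hpb : a * b * b = b := by rw [hc.eq, hb]
  calc c * b = c * (a * b) * b := by rw [mul_assoc, hpb]
    _ = b * a * c * b := by rw [h3.eq, hc.eq]
    _ = b * (c * (a * b)) := by rw [mul_assoc b a, ← hca.eq]; simp only [mul_assoc]
    _ = b * c := by rw [h3.eq, ← mul_assoc, hbp]

theorem IsDrazinInvertible.map {M N F : Type*} [Monoid M] [Monoid N] [FunLike F M N]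
    [MonoidHomClass F M N] {a : M} (h : IsDrazinInvertible a) (f : F) : IsDrazinInvertible (f a) := by
  obtain ⟨b, m, h1, h2, h3⟩ := h
  exact ⟨f b, m, by simp only [← map_mul, ← map_pow, ← h1], by simp only [← map_mul, h2],
    by simp only [← map_mul, h3]⟩

theorem IsDrazinInvertible.op {M : Type*} [Monoid M] {a : M} (h : IsDrazinInvertible a) :
    IsDrazinInvertible (MulOpposite.op a) := by
  obtain ⟨b, m, h1, h2, h3⟩ := h
  refine .of_pow_succ_mul (b := MulOpposite.op b) (m := m) ?_ ?_
  · exact congrArg MulOpposite.op h3.symm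
  · rw [← MulOpposite.op_pow, ← MulOpposite.op_mul, ← MulOpposite.op_pow]
    have hc : Commute a b := h3
    rw [← (hc.pow_left (m + 1)).eq, pow_succ, mul_assoc, hc.eq, ← mul_assoc, ← h1]

theorem IsDrazinInvertible.neg {R : Type*} [Ring R] {a : R} (h : IsDrazinInvertible a) :
    IsDrazinInvertible (-a) := by
  obtain ⟨b, m, h1, h2, h3⟩ := h
  refine ⟨-b, m, ?_, by simp [h2], by simp [h3]⟩
  rw [neg_pow]
  simp only [mul_neg, neg_mul, neg_neg]
  rw [mul_assoc, mul_assoc, ← mul_assoc _ b, ← h1]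

/-- In a commutative ring, a Drazin invertible element has a spectral idempotent `p`: `a` is
nilpotent on the range of `p`, and is inverted by `d` on the range of `1 - p`. -/
theorem IsDrazinInvertible.exists_idempotent {R : Type*} [CommRing R] {a : R}
    (h : IsDrazinInvertible a) :
    ∃ p d : R, IsIdempotentElem p ∧ IsNilpotent (a * p) ∧ a * d = 1 - p ∧ d * p = 0 := by
  obtain ⟨d, m, h1, h2, -⟩ := h
  refine ⟨1 - a * d, d, ?_, ⟨m + 1, ?_⟩, by ring, by linear_combination -h2⟩
  · rw [IsIdempotentElem]; linear_combination a * h2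
  · rw [mul_pow, pow_succ, pow_succ]
    linear_combination a * (1 - a * d) ^ m * h1

/-- If an idempotent `e` makes `a * e` nilpotent and `a + e` invertible, then `a` is Drazin
invertible. -/
theorem IsDrazinInvertible.of_idempotent {R : Type*} [CommRing R] {a e : R}
    (he : IsIdempotentElem e) (hn : IsNilpotent (a * e)) (hu : IsUnit (a + e)) :
    IsDrazinInvertible a := by
  obtain ⟨m, hm⟩ := hn
  obtain ⟨u, hu⟩ := hu.exists_right_inv
  refine .of_pow_succ_mul (b := u * (1 - e)) (m := m + 1) (Commute.all _ _) ?_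
  have h1 : a * (u * (1 - e)) = 1 - e := by
    rw [IsIdempotentElem] at he
    linear_combination (1 - e) * hu + u * he
  have h2 : a ^ (m + 1) * e = 0 := by
    rw [← he.pow_succ_eq m, ← mul_pow, pow_succ, hm, zero_mul]
  rw [pow_succ, mul_assoc, h1, mul_sub, h2, mul_one, sub_zero]

/-! ### Sums of commuting Drazin invertible elements -/

/-- Two commuting elements of a complex Banach algebra lie in a commutative Banach algebra
closed under everything lying in their bicommutant, namely the bicommutant itself. -/
theorem exists_commutative_bicommutant {R : Type u} [NormedRing R] [NormedAlgebra ℂ R]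
    [CompleteSpace R] {a b : R} (hab : Commute a b) :
    ∃ (C : Type u) (_ : NormedCommRing C) (_ : NormedAlgebra ℂ C) (_ : CompleteSpace C)
      (ι : C →ₐ[ℂ] R), Function.Injective ι ∧
        ∀ x, x ∈ Set.range ι ↔ ∀ c, Commute c a → Commute c b → Commute c x := by
  let s : Set R := {a, b}
  let C : Subalgebra ℂ R := Subalgebra.centralizer ℂ (Set.centralizer s)
  have hs : ∀ c, c ∈ Set.centralizer s ↔ Commute c a ∧ Commute c b := by
    intro c
    simp only [s, Set.mem_centralizer_iff, Set.mem_insert_iff, Set.mem_singleton_iff,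
      forall_eq_or_imp, forall_eq, Commute, SemiconjBy]
    exact and_congr eq_comm eq_comm
  have hC : ∀ x, x ∈ C ↔ ∀ c, Commute c a → Commute c b → Commute c x := by
    intro x
    rw [Subalgebra.mem_centralizer_iff]
    exact ⟨fun h c h1 h2 => h c ((hs c).2 ⟨h1, h2⟩),
      fun h c hc => h c ((hs c).1 hc).1 ((hs c).1 hc).2⟩
  have hcomm : ∀ x y : C, x * y = y * x := by
    intro x y
    have ha := (hC x).1 x.2 a rfl hab
    have hb := (hC x).1 x.2 b hab.symm rfl
    exact Subtype.ext ((hC y).1 y.2 x ha.symm hb.symm)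
  let _ : NormedCommRing C := { (inferInstance : NormedRing C) with mul_comm := hcomm }
  refine ⟨C, inferInstance, { (inferInstance : Algebra ℂ C) with
    norm_smul_le := fun r x => norm_smul_le r (x : R) }, ?_,
    { toFun := fun x => (x : R), map_one' := rfl, map_mul' := fun _ _ => rfl, map_zero' := rfl,
      map_add' := fun _ _ => rfl, commutes' := fun _ => rfl }, Subtype.val_injective, ?_⟩
  · exact (Set.isClosed_centralizer (Set.centralizer s)).completeSpace_coe
  · intro x
    rw [← hC]
    exact ⟨by rintro ⟨y, rfl⟩; exact y.2, fun h => ⟨⟨x, h⟩, rfl⟩⟩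

/-- Drazin inverses do not leave the bicommutant. -/
theorem IsDrazinInvertible.of_map_bicommutant {R C : Type*} [Ring R] [Ring C] {a b : R}
    {ι : C →+* R} (hι : Function.Injective ι)
    (hr : ∀ x, x ∈ Set.range ι ↔ ∀ c, Commute c a → Commute c b → Commute c x) {x : C}
    (h : IsDrazinInvertible (ι x)) : IsDrazinInvertible x := by
  obtain ⟨d, m, h1, h2, h3⟩ := h
  obtain ⟨d, rfl⟩ := (hr d).2 fun c hca hcb =>
    Commute.drazin_inverse h1 h2 h3 ((hr (ι x)).1 ⟨x, rfl⟩ c hca hcb)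
  exact ⟨d, m, hι (by simpa using h1), hι (by simpa using h2), hι (by simpa using h3)⟩

theorem isUnit_of_map_bicommutant {R C : Type*} [Ring R] [Ring C] {a b : R}
    {ι : C →+* R} (hι : Function.Injective ι)
    (hr : ∀ x, x ∈ Set.range ι ↔ ∀ c, Commute c a → Commute c b → Commute c x) {x : C}
    (h : IsUnit (ι x)) : IsUnit x := by
  obtain ⟨u, hu⟩ := h
  obtain ⟨d, hd⟩ := (hr ↑u⁻¹).2 fun c hca hcb => by
    have := (hr (ι x)).1 ⟨x, rfl⟩ c hca hcb
    rw [← hu] at this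
    exact this.units_inv_right
  refine ⟨⟨x, d, hι ?_, hι ?_⟩, rfl⟩ <;> simp [hd, ← hu]

/-- Zero is not an accumulation point of the spectrum of a Drazin invertible element. -/
theorem IsDrazinInvertible.eventually_isUnit_sub {R : Type*} [NormedRing R] [NormedAlgebra ℂ R]
    [CompleteSpace R] {a : R} (h : IsDrazinInvertible a) :
    ∀ᶠ z in nhdsWithin (0 : ℂ) {0}ᶜ, IsUnit (a - algebraMap ℂ R z) := by
  obtain ⟨C, _, _, _, ι, hι, hr⟩ := exists_commutative_bicommutant (Commute.refl a)
  obtain ⟨a, rfl⟩ := (hr a).2 fun c hc _ => hc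
  obtain ⟨p, d, hp, hn, hd, hdp⟩ :=
    (h.of_map_bicommutant (ι := (ι : C →+* R)) hι hr).exists_idempotent
  have hopen : ∀ᶠ z in nhds (0 : ℂ), IsUnit (1 - algebraMap ℂ C z * d) := by
    have hcont : Continuous fun z : ℂ => 1 - algebraMap ℂ C z * d := by fun_prop
    exact hcont.continuousAt.eventually
      ((Units.isOpen (R := C)).mem_nhds (by simp))
  filter_upwards [nhdsWithin_le_nhds hopen, self_mem_nhdsWithin] with z hz hz0
  have hz0 : z ≠ 0 := hz0
  obtain ⟨u, hu⟩ := hz.exists_right_inv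
  -- On the range of `1 - p`, `a` is inverted by `d`; on the range of `p` it is nilpotent.
  obtain ⟨v, hv⟩ := (hn.isUnit_add_left_of_commute (u := -algebraMap ℂ C z)
    ((IsUnit.mk0 z hz0).map (algebraMap ℂ C)).neg (Commute.all _ _)).exists_right_inv
  have key : (a - algebraMap ℂ C z) * (d * u + p * v) = 1 := by
    rw [IsIdempotentElem] at hp
    linear_combination u * hd + (1 - p) * hu - algebraMap ℂ C z * u * hdp + p * hv - a * v * hp
  simpa using (IsUnit.of_mul_eq_one _ key).map ι

/-- In a commutative Banach algebra, `a - b` is Drazin invertible as soon as `a` and `b` have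
finitely many common spectral values, at each of which both are Drazin invertible. -/
theorem isDrazinInvertible_sub_of_finite {C : Type*} [NormedCommRing C] [NormedAlgebra ℂ C]
    [CompleteSpace C] {a b : C} (K : Finset ℂ)
    (hK : ∀ z ∉ K, IsUnit (a - algebraMap ℂ C z) ∨ IsUnit (b - algebraMap ℂ C z))
    (ha : ∀ z ∈ K, IsDrazinInvertible (a - algebraMap ℂ C z))
    (hb : ∀ z ∈ K, IsDrazinInvertible (b - algebraMap ℂ C z)) :
    IsDrazinInvertible (a - b) := by
  choose! p d hp hpn hpd _ using fun z hz => (ha z hz).exists_idempotent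
  choose! q c hq hqn hqc _ using fun z hz => (hb z hz).exists_idempotent
  have hfi : IsIdempotentElem (∏ z ∈ K, (1 - p z * q z)) := by
    rw [IsIdempotentElem, ← Finset.prod_mul_distrib]
    exact Finset.prod_congr rfl fun z hz => ((hp z hz).mul (hq z hz)).one_sub
  have hnil : ∀ z ∈ K, IsNilpotent ((a - b) * (p z * q z)) := fun z hz => by
    have : (a - b) * (p z * q z) = q z * ((a - algebraMap ℂ C z) * p z)
        - p z * ((b - algebraMap ℂ C z) * q z) := by ring
    rw [this]
    exact (Commute.all _ _).isNilpotent_sub ((Commute.all _ _).isNilpotent_mul_left (hpn z hz))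
      ((Commute.all _ _).isNilpotent_mul_left (hqn z hz))
  -- With `e = 1 - ∏ z ∈ K, (1 - p z * q z)`, a character `φ` sends `e` to `1` if `φ a = φ b` and
  -- to `0` otherwise, because it sends `p z * q z` to `1` exactly when `φ a = z = φ b`. Hence
  -- no character vanishes on `a - b + e`.
  refine .of_idempotent (e := 1 - ∏ z ∈ K, (1 - p z * q z)) hfi.one_sub ?_ ?_
  · have : ∀ s ⊆ K, IsNilpotent ((a - b) * (1 - ∏ z ∈ s, (1 - p z * q z))) := by
      intro s
      induction s using Finset.induction_on with
      | empty => simp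
      | insert z s hzs ih =>
        intro hs
        rw [Finset.prod_insert hzs]
        have : (a - b) * (1 - (1 - p z * q z) * ∏ z ∈ s, (1 - p z * q z)) =
          (a - b) * (1 - ∏ z ∈ s, (1 - p z * q z)) +
            (∏ z ∈ s, (1 - p z * q z)) * ((a - b) * (p z * q z)) := by ring
        rw [this]
        exact (Commute.all _ _).isNilpotent_add
          (ih ((Finset.subset_insert z s).trans hs))
          ((Commute.all _ _).isNilpotent_mul_left (hnil z (hs (Finset.mem_insert_self z s))))
    exact this K subset_rfl
  · by_contra hu
    obtain ⟨φ, hφ⟩ := WeakDual.CharacterSpace.exists_apply_eq_zero hu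
    have hφz : ∀ z, φ (algebraMap ℂ C z) = z := fun z => AlgHomClass.commutes φ z
    simp only [map_add, map_sub, map_one, map_prod, map_mul] at hφ
    have hpz : ∀ z ∈ K, φ (p z) * (φ a - z) = 0 := fun z hz => by
      have := (hpn z hz).map φ
      rw [isNilpotent_iff_eq_zero, map_mul, map_sub, hφz] at this
      rw [mul_comm, this]
    have hqz : ∀ z ∈ K, φ (q z) * (φ b - z) = 0 := fun z hz => by
      have := (hqn z hz).map φ
      rw [isNilpotent_iff_eq_zero, map_mul, map_sub, hφz] at this
      rw [mul_comm, this]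
    by_cases hab : φ a = φ b
    · have hmem : φ a ∈ K := by
        by_contra h
        rcases hK _ h with h' | h'
        · have := h'.map φ
          simp [hφz] at this
        · have := h'.map φ
          simp [hφz, hab] at this
      have h1 := congrArg φ (hpd _ hmem)
      have h2 := congrArg φ (hqc _ hmem)
      simp only [map_mul, map_sub, map_one, hφz, sub_self, zero_mul] at h1 h2
      rw [← hab, sub_self, zero_mul] at h2
      rw [Finset.prod_eq_zero hmem (by rw [← sub_eq_zero.1 h1.symm, ← sub_eq_zero.1 h2.symm]; simp),
        hab] at hφ
      simp at hφ
    · rw [Finset.prod_eq_one] at hφ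
      · exact hab (by linear_combination hφ)
      · intro z hz
        rw [sub_eq_self]
        have : φ (p z) * φ (q z) * (φ a - φ b) = 0 := by
          linear_combination φ (q z) * hpz z hz - φ (p z) * hqz z hz
        exact (mul_eq_zero.1 this).resolve_right (sub_ne_zero.2 hab)

/-- The noncommutative form of `isDrazinInvertible_sub_of_finite`, obtained by working in the
bicommutant of `{a, b}`. -/
theorem Commute.isDrazinInvertible_sub {R : Type*} [NormedRing R] [NormedAlgebra ℂ R]
    [CompleteSpace R] {a b : R} (hab : Commute a b) (K : Finset ℂ)
    (hK : ∀ z ∉ K, IsUnit (a - algebraMap ℂ R z) ∨ IsUnit (b - algebraMap ℂ R z))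
    (ha : ∀ z ∈ K, IsDrazinInvertible (a - algebraMap ℂ R z))
    (hb : ∀ z ∈ K, IsDrazinInvertible (b - algebraMap ℂ R z)) :
    IsDrazinInvertible (a - b) := by
  obtain ⟨C, _, _, _, ι, hι, hr⟩ := exists_commutative_bicommutant hab
  obtain ⟨a', ha'⟩ := (hr a).2 fun c hc _ => hc
  obtain ⟨b', hb'⟩ := (hr b).2 fun c _ hc => hc
  have haz : ∀ z, ι (a' - algebraMap ℂ C z) = a - algebraMap ℂ R z := fun z => by
    rw [map_sub, ha', AlgHomClass.commutes]
  have hbz : ∀ z, ι (b' - algebraMap ℂ C z) = b - algebraMap ℂ R z := fun z => by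
    rw [map_sub, hb', AlgHomClass.commutes]
  have hunit : ∀ x, IsUnit (ι x) → IsUnit x := fun x =>
    isUnit_of_map_bicommutant (ι := (ι : C →+* R)) hι hr
  have hdrazin : ∀ x, IsDrazinInvertible (ι x) → IsDrazinInvertible x := fun x =>
    IsDrazinInvertible.of_map_bicommutant (ι := (ι : C →+* R)) hι hr
  have key := (isDrazinInvertible_sub_of_finite (a := a') (b := b') K
    (fun z hz => (hK z hz).imp (fun h => hunit _ (haz z ▸ h)) fun h => hunit _ (hbz z ▸ h))
    (fun z hz => hdrazin _ (haz z ▸ ha z hz))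
    (fun z hz => hdrazin _ (hbz z ▸ hb z hz))).map (ι : C →* R)
  rw [← ha', ← hb', ← map_sub]
  exact key

/-! ### Drazin invertibility through the dual space -/

/-- Hahn-Banach separation of a point from a closed subspace. -/
theorem Submodule.exists_dual_apply_ne_zero_of_notMem {E : Type*} [NormedAddCommGroup E]
    [NormedSpace ℂ E] {p : Submodule ℂ E} (hp : IsClosed (p : Set E)) {x : E} (hx : x ∉ p) :
    ∃ f : StrongDual ℂ E, f x ≠ 0 ∧ ∀ y ∈ p, f y = 0 := by
  have : ‖p.mkQ x‖ ≠ 0 := by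
    rw [Submodule.mkQ_apply, norm_ne_zero_iff, Ne, Submodule.Quotient.mk_eq_zero]
    exact hx
  obtain ⟨g, -, hg⟩ := exists_dual_vector ℂ (p.mkQ x) this
  refine ⟨g ∘L p.mkQL, ?_, fun y hy => ?_⟩
  · change g (p.mkQ x) ≠ 0
    rw [hg]
    exact Complex.ofReal_ne_zero.2 this
  · change g (p.mkQ y) = 0
    rw [Submodule.mkQ_apply, (Submodule.Quotient.mk_eq_zero p).2 hy, map_zero]

/-- If the adjoint `g ↦ g ∘ T` has a Drazin inverse `w` on the dual space, then `T` is Drazin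
invertible: `w` makes `T` bounded below with dense range on the closure of the range of
`T ^ m`. -/
theorem isDrazinInvertible_of_dual {E : Type*} [NormedAddCommGroup E] [NormedSpace ℂ E]
    [CompleteSpace E] {T : E →L[ℂ] E} (w : StrongDual ℂ E →L[ℂ] StrongDual ℂ E) (m : ℕ)
    (hw : ∀ g e, w (g ∘L T) e = w g (T e))
    (hm : ∀ g e, w g ((T ^ (m + 1)) e) = g ((T ^ m) e)) : IsDrazinInvertible T := by
  have hTm : ∀ k e, (T ^ (k + 1)) e = T ((T ^ k) e) := fun k e => by rw [pow_succ']; rfl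
  have hTm' : ∀ k e, (T ^ (k + 1)) e = (T ^ k) (T e) := fun k e => by rw [pow_succ]; rfl
  have hbound : ∀ e, ‖(T ^ m) e‖ ≤ ‖w‖ * ‖T ((T ^ m) e)‖ := fun e => by
    obtain ⟨g, hg, hge⟩ := exists_dual_vector'' ℂ ((T ^ m) e)
    calc ‖(T ^ m) e‖ = ‖g ((T ^ m) e)‖ := by rw [hge]; simp
      _ = ‖w g (T ((T ^ m) e))‖ := by rw [← hm, hTm]
      _ ≤ ‖w g‖ * ‖T ((T ^ m) e)‖ := (w g).le_opNorm _
      _ ≤ ‖w‖ * ‖T ((T ^ m) e)‖ := by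
        gcongr
        exact (w.le_opNorm g).trans (mul_le_of_le_one_right (norm_nonneg w) hg)
  let Z : Submodule ℂ E := (LinearMap.range (T ^ m : E →L[ℂ] E).toLinearMap).topologicalClosure
  have hZc : IsClosed (Z : Set E) := Submodule.isClosed_topologicalClosure _
  have hmemZ : ∀ e, (T ^ m) e ∈ Z := fun e =>
    Submodule.le_topologicalClosure _ (LinearMap.mem_range_self _ e)
  have hind : ∀ P : E → Prop, IsClosed {z | P z} → (∀ e, P ((T ^ m) e)) → ∀ z ∈ Z, P z := by
    intro P hP h z hz
    refine closure_minimal (s := Set.range (T ^ m : E →L[ℂ] E)) ?_ hP hz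
    rintro _ ⟨e, rfl⟩
    exact h e
  have hZb : ∀ z ∈ Z, ‖z‖ ≤ ‖w‖ * ‖T z‖ :=
    hind _ (isClosed_le continuous_norm (by fun_prop)) hbound
  have hZT : ∀ z ∈ Z, T z ∈ Z := hind _ (hZc.preimage T.continuous) fun e => by
    rw [← hTm, hTm']
    exact hmemZ _
  have : CompleteSpace Z := hZc.completeSpace_coe
  have hanti : AntilipschitzWith ‖w‖₊ (T ∘L Z.subtypeL) :=
    ContinuousLinearMap.antilipschitz_of_bound _ fun z => hZb z z.2
  have hclosed : IsClosed (Set.range (T ∘L Z.subtypeL)) :=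
    hanti.isClosed_range (T ∘L Z.subtypeL).uniformContinuous
  have hsurj : ∀ z ∈ Z, z ∈ Set.range (T ∘L Z.subtypeL) := hind _ hclosed fun e => by
    by_contra hne
    obtain ⟨g, hg0, hg⟩ := Submodule.exists_dual_apply_ne_zero_of_notMem
      (p := LinearMap.range (T ∘L Z.subtypeL).toLinearMap) hclosed hne
    have hgT : g ∘L (T ^ (m + 1)) = 0 := by
      ext y
      exact (congrArg g (hTm m y)).trans (hg _ ⟨⟨(T ^ m) y, hmemZ y⟩, rfl⟩)
    have hwk : ∀ k (g : StrongDual ℂ E) e, w (g ∘L (T ^ k)) e = w g ((T ^ k) e) := by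
      intro k
      induction k with
      | zero => intro g e; rfl
      | succ k ih =>
        intro g e
        have : g ∘L (T ^ (k + 1)) = (g ∘L (T ^ k)) ∘L T := by rw [pow_succ]; rfl
        rw [this, hw, ih, hTm']
    apply hg0
    rw [← hm, ← hwk, hgT, map_zero, zero_apply]
  let V : Z →L[ℂ] Z := (T ∘L Z.subtypeL).codRestrict Z fun z => hZT z z.2
  let P : E →L[ℂ] Z := (T ^ m).codRestrict Z hmemZ
  have hV : IsUnit V := by
    rw [ContinuousLinearMap.isUnit_iff_bijective]
    refine ⟨fun x y hxy => hanti.injective (congrArg Subtype.val hxy), fun z => ?_⟩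
    obtain ⟨y, hy⟩ := hsurj z z.2
    exact ⟨y, Subtype.ext hy⟩
  obtain ⟨u, hu⟩ := hV
  have hTk : ∀ k, (T ^ k) ∘L Z.subtypeL = Z.subtypeL ∘L (V ^ k) := by
    intro k
    induction k with
    | zero => rfl
    | succ k ih =>
      have h1 : (T ^ (k + 1)) ∘L Z.subtypeL = T ∘L ((T ^ k) ∘L Z.subtypeL) := by rw [pow_succ']; rfl
      have h2 : V ^ (k + 1) = V ∘L (V ^ k) := pow_succ' V k
      rw [h1, ih, h2]
      rfl
  have hP : V ∘L P = P ∘L T := by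
    ext e
    exact (hTm m e).symm.trans (hTm' m e)
  -- The Drazin inverse is `T ^ m` followed by the inverse of `T ^ (m + 1)` on `Z`.
  let F : Z →L[ℂ] Z := ((u⁻¹ ^ (m + 1) : (Z →L[ℂ] Z)ˣ) : Z →L[ℂ] Z)
  have hVF : V * F = F * V := by
    rw [← hu]
    exact congrArg Units.val (((Commute.refl u).inv_right.pow_right (m + 1)).eq)
  have hVF' : V ^ (m + 1) * F = 1 := by
    rw [← hu]
    simp only [F, ← Units.val_mul, ← Units.val_pow_eq_pow_val]
    simp
  refine .of_pow_succ_mul (b := Z.subtypeL ∘L F ∘L P) (m := m) ?_ ?_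
  · change T ∘L (Z.subtypeL ∘L F ∘L P) = (Z.subtypeL ∘L F ∘L P) ∘L T
    calc T ∘L (Z.subtypeL ∘L F ∘L P) = Z.subtypeL ∘L ((V * F) ∘L P) := rfl
      _ = Z.subtypeL ∘L (F ∘L (V ∘L P)) := by rw [hVF]; rfl
      _ = _ := by rw [hP]; rfl
  · calc T ^ (m + 1) * (Z.subtypeL ∘L F ∘L P)
        = ((T ^ (m + 1)) ∘L Z.subtypeL) ∘L (F ∘L P) := rfl
      _ = Z.subtypeL ∘L ((V ^ (m + 1) * F) ∘L P) := by rw [hTk]; rfl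
      _ = T ^ m := by rw [hVF']; rfl

/-- A bounded sequence of bilinear forms has a pointwise limit along an ultrafilter. -/
theorem exists_tendsto_hyperfilter {E F : Type*} [NormedAddCommGroup E] [NormedSpace ℂ E]
    [NormedAddCommGroup F] [NormedSpace ℂ F] (G : ℕ → E →L[ℂ] F →L[ℂ] ℂ) {C : ℝ}
    (hG : ∀ n e f, ‖G n e f‖ ≤ C * ‖e‖ * ‖f‖) :
    ∃ w : E →L[ℂ] F →L[ℂ] ℂ, ∀ e f,
      Tendsto (fun n => G n e f) (hyperfilter ℕ) (𝓝 (w e f)) := by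
  have hlim : ∀ e f, ∃ z : ℂ, Tendsto (fun n => G n e f) (hyperfilter ℕ) (𝓝 z) := by
    intro e f
    obtain ⟨z, -, hz⟩ := (isCompact_closedBall (0 : ℂ) (C * ‖e‖ * ‖f‖)).ultrafilter_le_nhds
      ((hyperfilter ℕ).map fun n => G n e f)
      (le_principal_iff.2 (Filter.mem_map.2 (Filter.univ_mem' fun n => by
        simpa using hG n e f)))
    exact ⟨z, hz⟩
  choose W hW using hlim
  refine ⟨LinearMap.mkContinuous₂ (LinearMap.mk₂ ℂ W ?_ ?_ ?_ ?_) C ?_, hW⟩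
  · intro e e' f
    exact tendsto_nhds_unique (hW _ _) (((hW e f).add (hW e' f)).congr fun n => by simp)
  · intro c e f
    exact tendsto_nhds_unique (hW _ _) (((hW e f).const_smul c).congr fun n => by simp)
  · intro e f f'
    exact tendsto_nhds_unique (hW _ _) (((hW e f).add (hW e f')).congr fun n => by simp)
  · intro c e f
    exact tendsto_nhds_unique (hW _ _) (((hW e f).const_smul c).congr fun n => by simp)
  · intro e f
    exact le_of_tendsto (hW e f).norm (Filter.Eventually.of_forall fun n => hG n e f)

/-! ### Limits along approximate kernels -/

/-- Suppose that `s` is asymptotically annihilated by the forms `G n`, through which `t` acts as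
`T`. If `s + t` is Drazin invertible, then so is `T`: the limit of `G n D`, with `D` the Drazin
inverse of `s + t`, is a Drazin inverse of the adjoint of `T`. -/
theorem isDrazinInvertible_of_asymptotic {R E : Type*} [Ring R] [NormedAddCommGroup E]
    [NormedSpace ℂ E] [CompleteSpace E] {s t : R} (hst : Commute s t) {T : E →L[ℂ] E}
    (G : ℕ → R →+ (StrongDual ℂ E →L[ℂ] E →L[ℂ] ℂ))
    (hG : ∀ Z, ∃ C, ∀ n g e, ‖G n Z g e‖ ≤ C * ‖g‖ * ‖e‖)
    (hT : ∀ n Z g e, Commute Z t → G n Z g (T e) = G n (t * Z) g e)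
    (hT' : ∀ n Z g e, Commute Z t → G n Z (g ∘L T) e = G n (t * Z) g e)
    (hs : ∀ Z g e, Commute Z s → Tendsto (fun n => G n (s * Z) g e) atTop (𝓝 0))
    (h1 : ∀ n g e, G n 1 g e = g e) (h : IsDrazinInvertible (s + t)) :
    IsDrazinInvertible T := by
  obtain ⟨D, m, hm, hD, hc⟩ := h
  have hDs : Commute D s := (Commute.drazin_inverse hm hD hc
    ((Commute.refl s).add_right hst)).symm
  have hDt : Commute D t := (Commute.drazin_inverse hm hD hc
    (hst.symm.add_right (Commute.refl t))).symm
  obtain ⟨C, hC⟩ := hG D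
  obtain ⟨w, hw⟩ := exists_tendsto_hyperfilter (fun n => G n D) hC
  have hpow : ∀ k n Z g e, Commute Z t → G n Z g ((T ^ k) e) = G n (t ^ k * Z) g e := by
    intro k
    induction k with
    | zero => intro n Z g e _; simp
    | succ k ih =>
      intro n Z g e hZ
      have : (T ^ (k + 1)) e = T ((T ^ k) e) := by rw [pow_succ']; rfl
      rw [this, hT n Z g _ hZ, ih n _ g e ((Commute.refl t).mul_left hZ), pow_succ, mul_assoc]
  -- Modulo `s`, the powers of `s + t` and of `t` agree.
  have hdiv : ∀ k, ∃ Q, Commute Q s ∧ (s + t) ^ k = t ^ k + s * Q := by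
    intro k
    have hstt : Commute (s + t) t := hst.add_left (Commute.refl t)
    have hsts : Commute (s + t) s := (Commute.refl s).add_left hst.symm
    refine ⟨∑ i ∈ Finset.range k, (s + t) ^ i * t ^ (k - 1 - i), ?_, ?_⟩
    · exact Commute.sum_left _ _ _ fun i _ =>
        (hsts.pow_left i).mul_left (hst.symm.pow_left _)
    · have := hstt.mul_geom_sum₂ k
      rw [add_sub_cancel_right] at this
      rw [this]
      abel
  have hle : (hyperfilter ℕ : Filter ℕ) ≤ atTop := by
    rw [← Nat.cofinite_eq_atTop]
    exact hyperfilter_le_cofinite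
  refine isDrazinInvertible_of_dual w m (fun g e => ?_) fun g e => ?_
  · refine tendsto_nhds_unique (hw _ _) ((hw g (T e)).congr fun n => ?_)
    rw [hT n D g e hDt, hT' n D g e hDt]
  · obtain ⟨Q, hQ, hQm⟩ := hdiv m
    obtain ⟨Q', hQ', hQm'⟩ := hdiv (m + 1)
    have hmD : (s + t) ^ (m + 1) * D = (s + t) ^ m := by
      rw [pow_succ, mul_assoc, hc, ← mul_assoc, ← hm]
    have hkey : t ^ (m + 1) * D = t ^ m + s * (Q - Q' * D) := by
      have h2 : t ^ (m + 1) * D = (s + t) ^ (m + 1) * D - s * Q' * D := by rw [hQm']; noncomm_ring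
      rw [h2, hmD, hQm]
      noncomm_ring
    have hlim := (hs (Q - Q' * D) g e (hQ.sub_left (hQ'.mul_left hDs))).mono_left hle
    have hlim' := hlim.const_add (g ((T ^ m) e))
    rw [add_zero] at hlim'
    refine tendsto_nhds_unique (hw _ _) (hlim'.congr fun n => ?_)
    rw [hpow _ n D g e hDt, hkey, AddMonoidHom.map_add, ← h1 n,
      hpow m n 1 g e (Commute.one_left t), mul_one]
    rfl

/-- A non-invertible operator has approximate eigenvectors for the eigenvalue `0`, either on the
space itself or on the dual space. -/
theorem exists_approximate_kernel {E : Type*} [NormedAddCommGroup E] [NormedSpace ℂ E]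
    [CompleteSpace E] {T : E →L[ℂ] E} (hT : ¬ IsUnit T) :
    ∃ (x : ℕ → E) (f : ℕ → StrongDual ℂ E) (C : ℝ), (∀ n, ‖x n‖ ≤ C) ∧ (∀ n, ‖f n‖ ≤ C) ∧
      (∀ n, f n (x n) = 1) ∧ (Tendsto (fun n => T (x n)) atTop (𝓝 0) ∨ ∀ n e, f n (T e) = 0) := by
  by_cases hb : ∃ c, AntilipschitzWith c T
  · obtain ⟨c, hc⟩ := hb
    have hclosed := hc.isClosed_range T.uniformContinuous
    have hsurj : ¬ Function.Surjective T := fun h =>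
      hT (ContinuousLinearMap.isUnit_iff_bijective.2 ⟨hc.injective, h⟩)
    simp only [Function.Surjective, not_forall] at hsurj
    obtain ⟨y, hy⟩ := hsurj
    obtain ⟨f, hf, hf0⟩ := Submodule.exists_dual_apply_ne_zero_of_notMem
      (p := LinearMap.range T.toLinearMap) hclosed (x := y) hy
    refine ⟨fun _ => (f y)⁻¹ • y, fun _ => f, max ‖(f y)⁻¹ • y‖ ‖f‖, fun _ => le_max_left _ _,
      fun _ => le_max_right _ _, fun _ => ?_, Or.inr fun _ e => hf0 _ ⟨e, rfl⟩⟩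
    rw [map_smul, smul_eq_mul, inv_mul_cancel₀ hf]
  · have hx : ∀ n : ℕ, ∃ x : E, ‖x‖ = 1 ∧ ‖T x‖ ≤ 1 / ((n : ℝ) + 1) := by
      intro n
      by_contra! hn
      refine hb ⟨((n : NNReal) + 1), ContinuousLinearMap.antilipschitz_of_bound _ fun x => ?_⟩
      rcases eq_or_ne x 0 with rfl | hx
      · simp
      have hx' : 0 < ‖x‖ := norm_pos_iff.2 hx
      have h1 := hn ((‖x‖ : ℂ)⁻¹ • x) (by
        rw [norm_smul, norm_inv, Complex.norm_real, norm_norm, inv_mul_cancel₀ hx'.ne'])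
      rw [map_smul, norm_smul, norm_inv, Complex.norm_real, norm_norm,
        div_lt_iff₀ (by positivity), inv_mul_eq_div, div_mul_eq_mul_div, lt_div_iff₀ hx'] at h1
      push_cast
      linarith
    choose x hx1 hx2 using hx
    choose f hf1 hf2 using fun n => exists_dual_vector ℂ (x n) (by rw [hx1 n]; exact one_ne_zero)
    refine ⟨x, f, 1, fun n => (hx1 n).le, fun n => (hf1 n).le, fun n => ?_, Or.inl ?_⟩
    · rw [hf2, hx1]; simp
    · exact squeeze_zero_norm hx2 tendsto_one_div_add_atTop_nhds_zero_nat

/-! ### Left and right multiplication operators -/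

section Coefficients

variable {X Y : Type*} [NormedAddCommGroup X] [NormedSpace ℂ X]
  [NormedAddCommGroup Y] [NormedSpace ℂ Y]

/-- Left multiplication `U ↦ A U`, as a homomorphism in `A`. -/
noncomputable def leftMulHom (X Y : Type*) [NormedAddCommGroup X] [NormedSpace ℂ X]
    [NormedAddCommGroup Y] [NormedSpace ℂ Y] :
    (X →L[ℂ] X) →ₐ[ℂ] ((Y →L[ℂ] X) →L[ℂ] (Y →L[ℂ] X)) where
  toFun A := ContinuousLinearMap.compL ℂ Y X X A
  map_one' := rfl
  map_mul' _ _ := rfl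
  map_zero' := map_zero _
  map_add' := map_add _
  commutes' _ := rfl

/-- Right multiplication `U ↦ U B`, as a homomorphism in `B` from the opposite algebra. -/
noncomputable def rightMulHom (X Y : Type*) [NormedAddCommGroup X] [NormedSpace ℂ X]
    [NormedAddCommGroup Y] [NormedSpace ℂ Y] :
    (Y →L[ℂ] Y)ᵐᵒᵖ →ₐ[ℂ] ((Y →L[ℂ] X) →L[ℂ] (Y →L[ℂ] X)) where
  toFun B := (ContinuousLinearMap.compL ℂ Y Y X).flip B.unop
  map_one' := rfl
  map_mul' _ _ := rfl
  map_zero' := map_zero _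
  map_add' _ _ := map_add _ _ _
  commutes' z := by
    ext U y
    change U (z • y) = z • U y
    exact map_smul U z y

theorem commute_leftMulHom_rightMulHom (A : X →L[ℂ] X) (B : (Y →L[ℂ] Y)ᵐᵒᵖ) :
    Commute (leftMulHom X Y A) (rightMulHom X Y B) := rfl

theorem generalizedDerivation_eq_sub (A : X →L[ℂ] X) (B : Y →L[ℂ] Y) :
    generalizedDerivation A B = leftMulHom X Y A - rightMulHom X Y (MulOpposite.op B) := rfl

/-- Shifting both coefficients by scalars shifts the derivation by the difference. -/
theorem generalizedDerivation_sub_sub (A : X →L[ℂ] X) (B : Y →L[ℂ] Y) (z w : ℂ) :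
    generalizedDerivation (A - z • ContinuousLinearMap.id ℂ X)
      (B - w • ContinuousLinearMap.id ℂ Y) =
      generalizedDerivation A B - (z - w) • ContinuousLinearMap.id ℂ (Y →L[ℂ] X) := by
  ext U y
  simp only [generalizedDerivation_apply, ContinuousLinearMap.comp_apply, sub_apply, smul_apply,
    ContinuousLinearMap.id_apply, map_sub, map_smul, sub_smul]
  abel

theorem commute_leftMulHom_iff {A : X →L[ℂ] X} {Z : (Y →L[ℂ] X) →L[ℂ] (Y →L[ℂ] X)} :
    Commute Z (leftMulHom X Y A) ↔ ∀ U, Z (A ∘L U) = A ∘L (Z U) :=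
  ContinuousLinearMap.ext_iff

theorem commute_rightMulHom_iff {B : Y →L[ℂ] Y} {Z : (Y →L[ℂ] X) →L[ℂ] (Y →L[ℂ] X)} :
    Commute Z (rightMulHom X Y (MulOpposite.op B)) ↔ ∀ U, Z (U ∘L B) = (Z U) ∘L B :=
  ContinuousLinearMap.ext_iff

open ContinuousLinearMap (compL smulRightL smulRight)

/-! ### Passing from the derivation to its coefficients -/

/-- With `x n` and `f n` approximating the kernel of `A` or of its adjoint, the forms
`(g, y) ↦ f n (Z (x n ⊗ g) y)` asymptotically annihilate left multiplication by `A`, so that the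
derivation acts on the rank one operators `x n ⊗ g` as `-B` does. -/
theorem IsDrazinInvertible.right_of_generalizedDerivation [CompleteSpace X] [CompleteSpace Y]
    {A : X →L[ℂ] X} {B : Y →L[ℂ] Y} (h : IsDrazinInvertible (generalizedDerivation A B))
    (hA : ¬ IsUnit A) : IsDrazinInvertible B := by
  obtain ⟨x, f, C, hx, hf, hfx, hAx⟩ := exists_approximate_kernel hA
  let G : ℕ → ((Y →L[ℂ] X) →L[ℂ] (Y →L[ℂ] X)) →+ (StrongDual ℂ Y →L[ℂ] Y →L[ℂ] ℂ) := fun n =>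
    AddMonoidHom.mk' (fun Z => (compL ℂ Y X ℂ (f n)) ∘L Z ∘L ((smulRightL ℂ Y X).flip (x n)))
      fun Z Z' => by ext; simp
  have hGa : ∀ n Z g y, G n Z g y = f n (Z (smulRight g (x n)) y) := fun _ _ _ _ => rfl
  have hC : 0 ≤ C := (norm_nonneg _).trans (hx 0)
  suffices IsDrazinInvertible (-B) by simpa using this.neg
  rw [generalizedDerivation_eq_sub, sub_eq_add_neg, ← map_neg, ← MulOpposite.op_neg] at h
  refine isDrazinInvertible_of_asymptotic (commute_leftMulHom_rightMulHom _ _) G ?_ ?_ ?_ ?_ ?_ h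
  · intro Z
    refine ⟨C * ‖Z‖ * C, fun n g y => ?_⟩
    calc ‖G n Z g y‖ ≤ C * (‖Z‖ * (‖g‖ * C) * ‖y‖) := by
          refine (f n).le_of_opNorm_le_of_le (hf n) ((Z _).le_of_opNorm_le
            (Z.le_opNorm_of_le ?_) _)
          refine (ContinuousLinearMap.norm_smulRight_apply g (x n)).trans_le ?_
          gcongr
          exact hx n
      _ = C * ‖Z‖ * C * ‖g‖ * ‖y‖ := by ring
  · intro n Z g y _
    rfl
  · intro n Z g y hZ
    rw [hGa, hGa]
    exact congrArg (fun U : Y →L[ℂ] X => f n (U y))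
      (commute_rightMulHom_iff.1 hZ (smulRight g (x n)))
  · intro Z g y hZ
    rcases hAx with hAx | hAx
    · have hlim : Tendsto (fun n => Z (smulRight g (A (x n))) y) atTop (𝓝 0) := by
        have : Continuous fun x : X => Z (smulRight g x) y :=
          ((ContinuousLinearMap.apply ℂ X y) ∘L Z ∘L (smulRightL ℂ Y X g)).continuous
        have h0 : Z (smulRight g 0) y = 0 := by
          rw [show smulRight g (0 : X) = 0 by ext; simp]
          simp
        exact h0 ▸ (this.tendsto 0).comp hAx
      refine squeeze_zero_norm (a := fun n => C * ‖Z (smulRight g (A (x n))) y‖) (fun n => ?_)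
        (by simpa using hlim.norm.const_mul C)
      rw [hGa, ← hZ.eq]
      have : A ∘L smulRight g (x n) = smulRight g (A (x n)) := by ext; simp
      calc ‖f n (Z (A ∘L smulRight g (x n)) y)‖
          ≤ ‖f n‖ * ‖Z (A ∘L smulRight g (x n)) y‖ := (f n).le_opNorm _
        _ ≤ _ := by rw [this]; gcongr; exact hf n
    · refine tendsto_const_nhds.congr fun n => ?_
      exact (hAx n _).symm
  · intro n g y
    rw [hGa]
    simp [hfx]

/-- The same argument with the forms `(g, x) ↦ g (Z (x ⊗ f n) (y n))`, which asymptotically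
annihilate right multiplication by `B`. -/
theorem IsDrazinInvertible.left_of_generalizedDerivation [CompleteSpace X] [CompleteSpace Y]
    {A : X →L[ℂ] X} {B : Y →L[ℂ] Y} (h : IsDrazinInvertible (generalizedDerivation A B))
    (hB : ¬ IsUnit B) : IsDrazinInvertible A := by
  obtain ⟨y, f, C, hy, hf, hfy, hBy⟩ := exists_approximate_kernel hB
  let G : ℕ → ((Y →L[ℂ] X) →L[ℂ] (Y →L[ℂ] X)) →+ (StrongDual ℂ X →L[ℂ] X →L[ℂ] ℂ) := fun n =>
    AddMonoidHom.mk' (fun Z => (compL ℂ X X ℂ).flip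
      ((ContinuousLinearMap.apply ℂ X (y n)) ∘L Z ∘L (smulRightL ℂ Y X (f n))))
      fun Z Z' => by ext; simp
  have hGa : ∀ n Z g x, G n Z g x = g (Z (smulRight (f n) x) (y n)) := fun _ _ _ _ => rfl
  have hC : 0 ≤ C := (norm_nonneg _).trans (hy 0)
  rw [generalizedDerivation_eq_sub, sub_eq_neg_add] at h
  refine isDrazinInvertible_of_asymptotic 
    (Commute.neg_left (R := (Y →L[ℂ] X) →L[ℂ] (Y →L[ℂ] X))
      (commute_leftMulHom_rightMulHom _ _).symm) G ?_ ?_ ?_ ?_ ?_ h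
  · intro Z
    refine ⟨‖Z‖ * C * C, fun n g x => ?_⟩
    calc ‖G n Z g x‖ ≤ ‖g‖ * (‖Z‖ * (C * ‖x‖) * C) := by
          refine g.le_opNorm_of_le ((Z _).le_of_opNorm_le_of_le (Z.le_opNorm_of_le ?_) (hy n))
          refine (ContinuousLinearMap.norm_smulRight_apply (f n) x).trans_le ?_
          gcongr
          exact hf n
      _ = ‖Z‖ * C * C * ‖g‖ * ‖x‖ := by ring
  · intro n Z g x hZ
    rw [hGa, hGa]
    have : smulRight (f n) (A x) = A ∘L smulRight (f n) x := by ext; simp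
    rw [this]
    exact congrArg (fun U : Y →L[ℂ] X => g (U (y n))) (commute_leftMulHom_iff.1 hZ _)
  · intro n Z g x _
    rfl
  · intro Z g x hZ
    replace hZ := (Commute.neg_right_iff (R := (Y →L[ℂ] X) →L[ℂ] (Y →L[ℂ] X))).1 hZ
    have hval : ∀ n, G n (-rightMulHom X Y (MulOpposite.op B) * Z) g x =
        -g (Z (smulRight (f n) x) (B (y n))) := by
      intro n
      rw [hGa, ← map_neg g]
      rfl
    simp only [hval]
    rw [← neg_zero]
    refine Tendsto.neg ?_
    rcases hBy with hBy | hBy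
    · refine squeeze_zero_norm
        (a := fun n => ‖g‖ * (‖Z‖ * (C * ‖x‖) * ‖B (y n)‖)) (fun n => ?_)
        (by simpa using (hBy.norm.const_mul (‖Z‖ * (C * ‖x‖))).const_mul ‖g‖)
      refine g.le_opNorm_of_le ((Z _).le_of_opNorm_le (Z.le_opNorm_of_le ?_) _)
      rw [ContinuousLinearMap.norm_smulRight_apply]
      gcongr
      exact hf n
    · refine tendsto_const_nhds.congr fun n => ?_
      have h0 : smulRight (f n) x ∘L B = 0 := by ext v; simp [hBy]
      have := commute_rightMulHom_iff.1 hZ (smulRight (f n) x)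
      rw [h0, map_zero] at this
      have := congrArg (fun U : Y →L[ℂ] X => g (U (y n))) this
      simpa using this
  · intro n g x
    rw [hGa]
    simp [hfy]

end Coefficients

/-! ### The Drazin spectrum of a generalized derivation -/

theorem mem_spectrum_iff_not_isUnit_sub_smul_id {E : Type*} [NormedAddCommGroup E]
    [NormedSpace ℂ E] {T : E →L[ℂ] E} {z : ℂ} :
    z ∈ spectrum ℂ T ↔ ¬ IsUnit (T - z • ContinuousLinearMap.id ℂ E) := by
  rw [spectrum.mem_iff, IsUnit.sub_iff, Algebra.algebraMap_eq_smul_one]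
  rfl

/-- A compact set of spectral values at each of which `T` is Drazin invertible is finite, since
such spectral values are isolated. -/
theorem finite_of_forall_notMem_drazinSpectrum {E : Type*} [NormedAddCommGroup E]
    [NormedSpace ℂ E] [CompleteSpace E] {T : E →L[ℂ] E} {K : Set ℂ} (hK : IsCompact K)
    (hKT : K ⊆ spectrum ℂ T) (hD : ∀ z ∈ K, z ∉ drazinSpectrum T) : K.Finite := by
  by_contra hinf
  obtain ⟨z, hz, hacc⟩ := Set.Infinite.exists_accPt_of_subset_isCompact hinf hK subset_rfl
  have hev := (not_not.1 (hD z hz)).eventually_isUnit_sub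
  rw [accPt_iff_frequently_nhdsNE] at hacc
  have hmap : Tendsto (fun w => w - z) (𝓝[≠] z) (𝓝[≠] 0) := by
    refine tendsto_nhdsWithin_of_tendsto_nhds_of_eventually_within _ ?_ ?_
    · refine Tendsto.mono_left ?_ nhdsWithin_le_nhds
      exact Continuous.tendsto' (by fun_prop) _ _ (sub_self z)
    · filter_upwards [self_mem_nhdsWithin] with w hw
      exact sub_ne_zero.2 hw
  obtain ⟨w, hw, hu⟩ := (hacc.and_eventually (hmap.eventually hev)).exists
  refine mem_spectrum_iff_not_isUnit_sub_smul_id.1 (hKT hw) ?_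
  rwa [Algebra.algebraMap_eq_smul_one, ContinuousLinearMap.one_def, sub_sub, ← add_smul,
    add_sub_cancel] at hu

/-- The hypothesis forces the common spectral values of `A` and `B` to be finite in number, which
reduces the claim to `Commute.isDrazinInvertible_sub` for the two multiplication operators. -/
theorem isDrazinInvertible_generalizedDerivation {X Y : Type*}
    [NormedAddCommGroup X] [NormedSpace ℂ X] [CompleteSpace X]
    [NormedAddCommGroup Y] [NormedSpace ℂ Y] [CompleteSpace Y]
    {A : X →L[ℂ] X} {B : Y →L[ℂ] Y}
    (h : ∀ z ∈ spectrum ℂ A ∩ spectrum ℂ B, z ∉ drazinSpectrum A ∧ z ∉ drazinSpectrum B) :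
    IsDrazinInvertible (generalizedDerivation A B) := by
  have hfin : (spectrum ℂ A ∩ spectrum ℂ B).Finite :=
    finite_of_forall_notMem_drazinSpectrum
      ((spectrum.isCompact A).inter_right (spectrum.isClosed B)) Set.inter_subset_right
      fun z hz => (h z hz).2
  have haz : ∀ z, leftMulHom X Y A - algebraMap ℂ _ z =
      leftMulHom X Y (A - z • ContinuousLinearMap.id ℂ X) := fun z => by
    rw [map_sub, ← AlgHomClass.commutes (leftMulHom X Y), Algebra.algebraMap_eq_smul_one,
      ContinuousLinearMap.one_def]
  have hbz : ∀ z, rightMulHom X Y (MulOpposite.op B) - algebraMap ℂ _ z =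
      rightMulHom X Y (MulOpposite.op (B - z • ContinuousLinearMap.id ℂ Y)) := fun z => by
    rw [MulOpposite.op_sub, map_sub, ← AlgHomClass.commutes (rightMulHom X Y),
      MulOpposite.algebraMap_apply, Algebra.algebraMap_eq_smul_one, ContinuousLinearMap.one_def]
  rw [generalizedDerivation_eq_sub]
  refine Commute.isDrazinInvertible_sub (R := (Y →L[ℂ] X) →L[ℂ] (Y →L[ℂ] X))
    (commute_leftMulHom_rightMulHom A (MulOpposite.op B)) hfin.toFinset
    (fun z hz => ?_) (fun z hz => ?_) fun z hz => ?_
  · rw [Set.Finite.mem_toFinset, Set.mem_inter_iff, not_and_or,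
      mem_spectrum_iff_not_isUnit_sub_smul_id, mem_spectrum_iff_not_isUnit_sub_smul_id,
      not_not, not_not] at hz
    rw [haz, hbz]
    exact hz.imp (fun hz => hz.map (leftMulHom X Y)) fun hz => hz.op.map (rightMulHom X Y)
  · rw [haz]
    exact (not_not.1 (h z (hfin.mem_toFinset.1 hz)).1).map (leftMulHom X Y)
  · rw [hbz]
    exact (not_not.1 (h z (hfin.mem_toFinset.1 hz)).2).op.map (rightMulHom X Y)

theorem theorem3p7 {X Y : Type*}
    [NormedAddCommGroup X] [NormedSpace ℂ X] [CompleteSpace X]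
    [NormedAddCommGroup Y] [NormedSpace ℂ Y] [CompleteSpace Y]
    (A : X →L[ℂ] X) (B : Y →L[ℂ] Y) :
    drazinSpectrum (generalizedDerivation A B) =
      (drazinSpectrum A - spectrum ℂ B) ∪ (spectrum ℂ A - drazinSpectrum B) := by
  refine Set.Subset.antisymm (fun l hl => ?_) ?_
  · -- Only `A` is shifted, by `l`; a common spectral value `z` of `A - l` and `B` comes from
    -- the pair `(l + z, z)`, whose difference is `l`.
    by_contra hn
    simp only [Set.mem_union, Set.mem_sub, not_or, not_exists, not_and] at hn
    apply hl
    have hz : l • ContinuousLinearMap.id ℂ (Y →L[ℂ] X) = (l - 0) • ContinuousLinearMap.id ℂ _ := by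
      rw [sub_zero]
    rw [hz, ← generalizedDerivation_sub_sub, zero_smul, sub_zero]
    have hA : ∀ z, A - l • ContinuousLinearMap.id ℂ X - z • ContinuousLinearMap.id ℂ X =
        A - (l + z) • ContinuousLinearMap.id ℂ X := fun z => by rw [sub_sub, ← add_smul]
    refine isDrazinInvertible_generalizedDerivation fun z hz => ?_
    have hzA : l + z ∈ spectrum ℂ A := by
      have := mem_spectrum_iff_not_isUnit_sub_smul_id.1 hz.1
      rw [hA] at this
      exact mem_spectrum_iff_not_isUnit_sub_smul_id.2 this
    refine ⟨fun hD => hn.1 (l + z) ?_ z hz.2 (by ring), fun hD => hn.2 (l + z) hzA z hD (by ring)⟩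
    simpa only [drazinSpectrum, Set.mem_ofPred_eq, hA] using hD
  · rintro l (⟨z, hz, w, hw, rfl⟩ | ⟨z, hz, w, hw, rfl⟩) h
    · refine hz (IsDrazinInvertible.left_of_generalizedDerivation ?_
        (mem_spectrum_iff_not_isUnit_sub_smul_id.1 hw))
      rw [generalizedDerivation_sub_sub]
      exact h
    · refine hw (IsDrazinInvertible.right_of_generalizedDerivation ?_
        (mem_spectrum_iff_not_isUnit_sub_smul_id.1 hz))
      rw [generalizedDerivation_sub_sub]
      exact h
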